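/- **Theorem 2.1.** Let $(R,\mathfrak m)$ be a Cohen–Macaulay local ring (commutative, Noetherian) of Krull dimension $d$. A nonzero finitely generated $R$-module $N$ is called maximal Cohen–Macaulay (MCM) if there is an $N$-regular sequence of length $d$; assume that $R$ has finite CM type, i.e. that up to isomorphism there are only finitely many indecomposable MCM $R$-modules. Let $M$ be a representation generator for $R$, i.e. an MCM $R$-module that contains every indecomposable MCM $R$-module, up to isomorphism, as a direct summand. Then $R$ is isomorphic to a direct summand of $M$, and the ring $A=\operatorname{End}_R(M)^{\mathrm{op}}$ has global dimension (the supremum of the projective dimensions of all left $A$-modules) $$\operatorname{gldim} A\le \max\{2,d\}.$$ If $d\ge 2$, then equality holds, i.e. $\operatorname{gldim}A=\max\{2,d\}=d$. -/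

import Mathlib

universe u

open CategoryTheory

noncomputable section

/-- A maximal Cohen–Macaulay module over a (Noetherian local) ring `R` of finite Krull dimension
`d`: a nonzero finitely generated module admitting a regular sequence of length `d`. (Over a local
ring the members of a regular sequence on a nonzero finitely generated module automatically lie
in the maximal ideal.) -/
structure IsMCM (R : Type u) [CommRing R] (M : Type u) [AddCommGroup M] [Module R M] : Prop where
  finite : Module.Finite R M
  nontrivial : Nontrivial M
  exists_regular : ∃ rs : List R,
    RingTheory.Sequence.IsRegular M rs ∧ ringKrullDim R = (rs.length : WithBot ℕ∞)

/-- A Cohen–Macaulay local ring: a Noetherian local ring that is maximal Cohen–Macaulay as a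
module over itself, i.e. has a regular sequence of length its Krull dimension. -/
structure IsCMLocalRing (R : Type u) [CommRing R] : Prop where
  isLocalRing : IsLocalRing R
  isNoetherianRing : IsNoetherianRing R
  isMCM_self : IsMCM R R

/-- An indecomposable module: nonzero, and not the internal direct sum of two nonzero
submodules. -/
structure IsIndecomposableModule (R : Type u) [CommRing R] (M : Type u) [AddCommGroup M]
    [Module R M] : Prop where
  nontrivial : Nontrivial M
  eq_bot_or_eq_bot : ∀ p q : Submodule R M, IsCompl p q → p = ⊥ ∨ q = ⊥

/-- `N` is isomorphic to a direct summand of `M`: there are maps `N → M → N` composing to the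
identity. -/
def IsDirectSummand (R : Type u) [CommRing R] (N M : Type u) [AddCommGroup N] [Module R N]
    [AddCommGroup M] [Module R M] : Prop :=
  ∃ (i : N →ₗ[R] M) (p : M →ₗ[R] N), p ∘ₗ i = LinearMap.id

/-- Finite Cohen–Macaulay type: up to isomorphism there are only finitely many indecomposable
maximal Cohen–Macaulay modules. -/
def HasFiniteCMType (R : Type u) [CommRing R] : Prop :=
  ∃ (n : ℕ) (X : Fin n → ModuleCat.{u} R), ∀ (N : Type u) [AddCommGroup N] [Module R N],
    IsMCM R N → IsIndecomposableModule R N → ∃ j, Nonempty (N ≃ₗ[R] X j)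

/-- A representation generator: a maximal Cohen–Macaulay module that contains every indecomposable
maximal Cohen–Macaulay module as a direct summand. -/
structure IsRepresentationGenerator (R : Type u) [CommRing R] (M : Type u) [AddCommGroup M]
    [Module R M] : Prop where
  isMCM : IsMCM R M
  isDirectSummand : ∀ (N : Type u) [AddCommGroup N] [Module R N],
    IsMCM R N → IsIndecomposableModule R N → IsDirectSummand R N M

/-- The (left) global dimension of a ring: the supremum of the projective dimensions of all its
left modules (`⊤` if unbounded, `⊥` for the zero ring). -/
def leftGlobalDimension (A : Type u) [Ring A] : WithBot ℕ∞ :=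
  ⨆ N : ModuleCat.{u} A, projectiveDimension N

end

open CategoryTheory Abelian

noncomputable section


/-! ### Global dimension is detected on cyclic modules. -/

section CyclicModules

variable {A : Type u} [Ring A]

/-! The module `R` is indecomposable MCM, so it splits off `M`; let `ε` be the resulting idempotent
of `A`. Then `X ↦ εX` is exact, `εA ≅ M`, and `A → Hom_R(εA, εA)` is bijective. Upper bound: a
second syzygy `X` over `A` satisfies `X ≅ Hom_R(εA, εX)`, and each syzygy raises the depth of `εX`
by one until it reaches `d`. At depth `d`, `εX` is a sum of indecomposable MCM modules, so it lies
in add `M`, and then `X` is projective (`InAdd.of_corner`). Thus `max 2 d` syzygies suffice for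
finitely generated modules, and cyclic modules determine the global dimension. Lower bound:
projective dimension at most `n ≤ d` forces depth of `εX` at least `d - n`, whereas the corner of
`A/𝔪A` is nonzero and killed by `𝔪`, hence of depth zero. -/

theorem Module.baer_of_subsingleton_ext_one (Y : ModuleCat.{u} A)
    (h : ∀ I : Ideal A, Subsingleton (Ext (ModuleCat.of A (A ⧸ I)) Y 1)) : Module.Baer A Y := by
  intro I g
  let S : ShortComplex (ModuleCat.{u} A) := ModuleCat.shortComplexOfCompEqZero
    I.subtype I.mkQ (by ext x; simp)
  have hS : S.ShortExact := ModuleCat.shortComplex_shortExact S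
    (LinearMap.exact_subtype_mkQ I) I.injective_subtype I.mkQ_surjective
  obtain ⟨x, hx⟩ := Ext.contravariant_sequence_exact₁ hS Y (Ext.mk₀ (ModuleCat.ofHom g))
    (add_zero 1) ((h I).elim _ _)
  obtain ⟨g', rfl⟩ := Ext.addEquiv₀.symm.surjective x
  refine ⟨g'.hom, fun x hx' ↦ ?_⟩
  have h2 : S.f ≫ g' = ModuleCat.ofHom g := by
    apply Ext.addEquiv₀.symm.injective
    simpa using hx
  exact congr($(h2).hom ⟨x, hx'⟩)

/-- Dimension shifting along an embedding into an injective reduces to `n = 0`, which is Baer's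
criterion. -/
theorem ModuleCat.hasInjectiveDimensionLT_of_subsingleton_ext (n : ℕ) (Y : ModuleCat.{u} A)
    (h : ∀ I : Ideal A, Subsingleton (Ext (ModuleCat.of A (A ⧸ I)) Y (n + 1))) :
    HasInjectiveDimensionLT Y (n + 1) := by
  induction n generalizing Y with
  | zero =>
    have : Module.Injective A Y := (Module.baer_of_subsingleton_ext_one Y h).injective
    have : Injective Y := Module.injective_object_of_injective_module A Y
    exact injective_iff_hasInjectiveDimensionLT_one.1 this
  | succ n ih =>
    let ⟨p⟩ := EnoughInjectives.presentation Y
    have hS : (ShortComplex.mk _ _ (Limits.cokernel.condition p.f)).ShortExact :=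
      { exact := ShortComplex.exact_cokernel p.f }
    refine (hS.hasInjectiveDimensionLT_X₃_iff n p.injective).1 (ih _ fun I ↦ ⟨fun x y ↦ ?_⟩)
    suffices ∀ x : Ext (ModuleCat.of A (A ⧸ I)) (Limits.cokernel p.f) (n + 1), x = 0 by
      rw [this x, this y]
    intro x
    have := p.injective
    obtain ⟨z, rfl⟩ := Ext.covariant_sequence_exact₃ _ hS x rfl ((h I).elim _ _)
    have hz : z = 0 := Ext.eq_zero_of_injective z
    rw [hz]; simp

theorem ModuleCat.hasProjectiveDimensionLT_of_cyclic (n : ℕ)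
    (h : ∀ I : Ideal A, HasProjectiveDimensionLT (ModuleCat.of A (A ⧸ I)) (n + 1))
    (X : ModuleCat.{u} A) : HasProjectiveDimensionLT X (n + 1) := by
  rw [hasProjectiveDimensionLT_iff]
  intro i hi Y e
  have := ModuleCat.hasInjectiveDimensionLT_of_subsingleton_ext n Y fun I ↦
    HasProjectiveDimensionLT.subsingleton _ (n + 1) _ le_rfl _
  exact e.eq_zero_of_hasInjectiveDimensionLT (n + 1) hi

end CyclicModules

/-! ### The class add `M`. -/

/-- `Z` is a retract of a finite direct sum of copies of `M`. -/
def InAdd (S : Type*) [Ring S] (M Z : Type*) [AddCommGroup M] [Module S M] [AddCommGroup Z]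
    [Module S Z] : Prop :=
  ∃ (ι : Type) (_ : Fintype ι) (σ : ι → Z →ₗ[S] M) (τ : ι → M →ₗ[S] Z),
    ∑ j, τ j ∘ₗ σ j = LinearMap.id

namespace InAdd

variable {S : Type*} [Ring S] {M N Z : Type*} [AddCommGroup M] [Module S M]
  [AddCommGroup N] [Module S N] [AddCommGroup Z] [Module S Z]

theorem of_retract (i : Z →ₗ[S] M) (p : M →ₗ[S] Z) (h : p ∘ₗ i = LinearMap.id) : InAdd S M Z :=
  ⟨Unit, inferInstance, fun _ ↦ i, fun _ ↦ p, by simpa using h⟩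

theorem of_linearEquiv (e : Z ≃ₗ[S] M) : InAdd S M Z :=
  of_retract e.toLinearMap e.symm.toLinearMap (by ext; simp)

theorem congr_left (e : M ≃ₗ[S] N) (h : InAdd S M Z) : InAdd S N Z := by
  obtain ⟨ι, _, σ, τ, h⟩ := h
  refine ⟨ι, inferInstance, fun j ↦ e.toLinearMap ∘ₗ σ j, fun j ↦ τ j ∘ₗ e.symm.toLinearMap, ?_⟩
  rw [← h]
  congr! 1 with j
  ext; simp

theorem of_subsingleton [Subsingleton Z] : InAdd S M Z :=
  of_retract 0 0 (Subsingleton.elim _ _)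

theorem pi (ι : Type) [Fintype ι] : InAdd S M (ι → M) := by
  classical
  refine ⟨ι, inferInstance, LinearMap.proj, fun j ↦ LinearMap.single S (fun _ ↦ M) j, ?_⟩
  ext j x k
  simp [Pi.single_apply]

theorem trans_retract (h : InAdd S M N) (i : Z →ₗ[S] N) (p : N →ₗ[S] Z)
    (hip : p ∘ₗ i = LinearMap.id) : InAdd S M Z := by
  obtain ⟨ι, _, σ, τ, h⟩ := h
  refine ⟨ι, inferInstance, fun j ↦ σ j ∘ₗ i, fun j ↦ p ∘ₗ τ j, ?_⟩
  ext z
  have h1 := congr($h (i z))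
  have h2 := congr($hip z)
  simp only [LinearMap.sum_apply, LinearMap.comp_apply, LinearMap.id_apply] at h1 h2 ⊢
  rw [← map_sum, h1, h2]

theorem of_isCompl {p q : Submodule S Z} (hpq : IsCompl p q) (hp : InAdd S M p)
    (hq : InAdd S M q) : InAdd S M Z := by
  obtain ⟨ι, _, σ, τ, h⟩ := hp
  obtain ⟨κ, _, σ', τ', h'⟩ := hq
  refine ⟨ι ⊕ κ, inferInstance,
    Sum.elim (fun j ↦ σ j ∘ₗ p.projectionOnto q hpq)
      (fun j ↦ σ' j ∘ₗ q.projectionOnto p hpq.symm),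
    Sum.elim (fun j ↦ p.subtype ∘ₗ τ j) (fun j ↦ q.subtype ∘ₗ τ' j), ?_⟩
  ext z
  have h1 := congr($h (p.projectionOnto q hpq z))
  have h2 := congr($h' (q.projectionOnto p hpq.symm z))
  simp only [Fintype.sum_sum_type, Sum.elim_inl, Sum.elim_inr, LinearMap.add_apply,
    LinearMap.sum_apply, LinearMap.comp_apply, LinearMap.id_apply] at h1 h2 ⊢
  rw [← map_sum, ← map_sum, h1, h2]
  simpa using Submodule.projection_add_projection_eq_self hpq z

theorem of_projective [Module.Finite S Z] [Module.Projective S Z] : InAdd S S Z := by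
  obtain ⟨n, f, hf⟩ := Module.Finite.exists_fin' S Z
  obtain ⟨g, hg⟩ := Module.projective_lifting_property f LinearMap.id hf
  exact (InAdd.pi (Fin n)).trans_retract g f hg

theorem projective (h : InAdd S S Z) : Module.Projective S Z := by
  obtain ⟨ι, _, σ, τ, h⟩ := h
  classical
  refine Module.Projective.of_split (LinearMap.pi σ)
    (LinearMap.lsum S (fun _ ↦ S) ℕ τ) ?_
  rw [← h]
  ext z
  simp [LinearMap.sum_apply]

end InAdd


/-! ### Depth via Ext from the residue field. -/

section Depth

variable {R : Type u} [CommRing R] [IsLocalRing R]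

/-- `N` has depth at least `n`, in terms of vanishing of `Ext` from the residue field. -/
def HasDepthGE (R : Type u) [CommRing R] [IsLocalRing R] (n : ℕ) (N : Type u) [AddCommGroup N]
    [Module R N] : Prop :=
  ∀ i < n, Subsingleton
    (Ext (ModuleCat.of R (R ⧸ IsLocalRing.maximalIdeal R)) (ModuleCat.of R N) i)

variable {K L C : Type u} [AddCommGroup K] [Module R K] [AddCommGroup L] [Module R L]
  [AddCommGroup C] [Module R C]

theorem HasDepthGE.mono {m n : ℕ} (h : HasDepthGE R n L) (hmn : m ≤ n) : HasDepthGE R m L :=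
  fun i hi ↦ h i (hi.trans_le hmn)

theorem HasDepthGE.zero : HasDepthGE R 0 L := fun _ h ↦ absurd h (Nat.not_lt_zero _)

/-- `Ext^i(k, K)` sits between `Ext^(i-1)(k, C)` and `Ext^i(k, L)`; this is the gain of one in depth
per syzygy. -/
theorem HasDepthGE.kernel {f : K →ₗ[R] L} {g : L →ₗ[R] C} (hf : Function.Injective f)
    (hfg : Function.Exact f g) (hg : Function.Surjective g) {n : ℕ} (hL : HasDepthGE R (n + 1) L)
    (hC : HasDepthGE R n C) : HasDepthGE R (n + 1) K := by
  let S : ShortComplex (ModuleCat.{u} R) :=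
    ModuleCat.shortComplexOfCompEqZero f g hfg.linearMap_comp_eq_zero
  have hS : S.ShortExact := ModuleCat.shortComplex_shortExact S hfg hf hg
  intro i hi
  suffices ∀ x : Ext (ModuleCat.of R (R ⧸ IsLocalRing.maximalIdeal R)) S.X₁ i, x = 0 from
    ⟨fun x y ↦ (this x).trans (this y).symm⟩
  intro x
  cases i with
  | zero =>
    apply Ext.postcomp_mk₀_injective_of_mono _ S.f (hf := hS.mono_f)
    exact (hL 0 hi).elim _ _
  | succ i =>
    obtain ⟨z, rfl⟩ := Ext.covariant_sequence_exact₁ _ hS x ((hL _ hi).elim _ _) rfl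
    rw [(hC i (by omega)).elim z 0, Ext.zero_comp]

theorem HasDepthGE.cokernel {f : K →ₗ[R] L} {g : L →ₗ[R] C} (hf : Function.Injective f)
    (hfg : Function.Exact f g) (hg : Function.Surjective g) {n : ℕ} (hL : HasDepthGE R n L)
    (hK : HasDepthGE R (n + 1) K) : HasDepthGE R n C := by
  let S : ShortComplex (ModuleCat.{u} R) :=
    ModuleCat.shortComplexOfCompEqZero f g hfg.linearMap_comp_eq_zero
  have hS : S.ShortExact := ModuleCat.shortComplex_shortExact S hfg hf hg
  intro i hi
  suffices ∀ x : Ext (ModuleCat.of R (R ⧸ IsLocalRing.maximalIdeal R)) S.X₃ i, x = 0 from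
    ⟨fun x y ↦ (this x).trans (this y).symm⟩
  intro x
  obtain ⟨z, rfl⟩ := Ext.covariant_sequence_exact₃ _ hS x rfl ((hK _ (by omega)).elim _ _)
  rw [(hL i hi).elim z 0, Ext.zero_comp]

theorem HasDepthGE.of_inAdd {n : ℕ} (hL : HasDepthGE R n L) (h : InAdd R L C) :
    HasDepthGE R n C := by
  obtain ⟨ι, _, σ, τ, h⟩ := h
  intro i hi
  suffices ∀ x : Ext (ModuleCat.of R (R ⧸ IsLocalRing.maximalIdeal R)) (ModuleCat.of R C) i,
    x = 0 from ⟨fun x y ↦ (this x).trans (this y).symm⟩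
  intro x
  have h' : ∑ j, ModuleCat.ofHom (σ j) ≫ ModuleCat.ofHom (τ j) = 𝟙 (ModuleCat.of R C) := by
    ext z
    simpa [ModuleCat.hom_sum] using congr($h z)
  rw [← x.comp_mk₀_id, ← h', Ext.mk₀_sum, Ext.comp_sum]
  refine Finset.sum_eq_zero fun j _ ↦ ?_
  rw [← Ext.mk₀_comp_mk₀, ← Ext.comp_assoc_of_second_deg_zero,
    (hL i hi).elim (x.comp (Ext.mk₀ (ModuleCat.ofHom (σ j))) (add_zero i)) 0, Ext.zero_comp]

theorem smul_maximalIdeal_lt_top [Module.Finite R L] [Nontrivial L] :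
    IsLocalRing.maximalIdeal R • (⊤ : Submodule R L) < ⊤ := by
  refine lt_top_iff_ne_top.2 (Submodule.top_ne_ideal_smul_of_le_jacobson_annihilator ?_).symm
  exact IsLocalRing.maximalIdeal_le_jacobson _

theorem mem_maximalIdeal_of_isRegular {rs : List R} (h : RingTheory.Sequence.IsRegular L rs)
    {r : R} (hr : r ∈ rs) : r ∈ IsLocalRing.maximalIdeal R := by
  refine IsLocalRing.le_maximalIdeal ?_ (Ideal.subset_span (show r ∈ {x | x ∈ rs} from hr))
  intro htop
  exact h.2 (by rw [Ideal.ofList, htop, Submodule.top_smul])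

/-- Rees' theorem, with its converse below: it trades regular sequences for Ext vanishing, which
passes through exact sequences and also holds for the zero module. -/
theorem IsMCM.hasDepthGE [IsNoetherianRing R] (h : IsMCM R L) {d : ℕ}
    (hd : ringKrullDim R = (d : WithBot ℕ∞)) : HasDepthGE R d L := by
  have := h.finite
  have := h.nontrivial
  obtain ⟨rs, hrs, hlen⟩ := h.exists_regular
  have : rs.length = d := by
    rw [hd] at hlen
    exact_mod_cast hlen.symm
  subst this
  refine ModuleCat.subsingleton_ext_of_exists_isRegular (IsLocalRing.maximalIdeal R)
    (ModuleCat.of R (R ⧸ IsLocalRing.maximalIdeal R)) ?_ (ModuleCat.of R L)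
    smul_maximalIdeal_lt_top rs (fun r hr ↦ mem_maximalIdeal_of_isRegular hrs hr) hrs
  rw [Module.support_eq_zeroLocus, Ideal.annihilator_quotient]

theorem HasDepthGE.isMCM [IsNoetherianRing R] [Module.Finite R L] [Nontrivial L] {d : ℕ}
    (hd : ringKrullDim R = (d : WithBot ℕ∞)) (h : HasDepthGE R d L) : IsMCM R L := by
  obtain ⟨rs, hlen, -, hrs⟩ := ModuleCat.exists_isRegular_of_exists_subsingleton_ext
    (IsLocalRing.maximalIdeal R) d (ModuleCat.of R L) smul_maximalIdeal_lt_top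
    (ModuleCat.of R (R ⧸ IsLocalRing.maximalIdeal R))
    (by rw [Module.support_eq_zeroLocus, Ideal.annihilator_quotient]) h
  exact ⟨‹_›, ‹_›, rs, hrs, by rw [hd, hlen]⟩

end Depth

/-! ### Decomposition into indecomposables. -/

section Decomposition

variable {R : Type u} [CommRing R]

theorem inAdd_of_isIndecomposable_summands [IsNoetherianRing R] {M Z : Type u} [AddCommGroup M]
    [Module R M] [AddCommGroup Z] [Module R Z] [Module.Finite R Z]
    (h : ∀ p q : Submodule R Z, IsCompl p q → IsIndecomposableModule R p → InAdd R M p) :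
    InAdd R M Z := by
  by_contra hZ
  let T : Set (Submodule R Z) := {q | ∃ p, IsCompl p q ∧ ¬ InAdd R M p}
  have hT : T.Nonempty := by
    refine ⟨⊥, ⊤, isCompl_top_bot, fun h' ↦ hZ ?_⟩
    exact h'.trans_retract (Submodule.topEquiv (R := R) (M := Z)).symm.toLinearMap
      Submodule.topEquiv.toLinearMap (by ext; simp)
  -- For `>`, minimal means that `q` is a largest complement of a bad summand `p`. If `p` splits,
  -- moving one piece into `q` enlarges it, so the other piece is good.
  obtain ⟨q, ⟨p, hpq, hp⟩, hmax⟩ := WellFounded.has_min (wellFounded_gt (α := Submodule R Z)) T hT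
  refine hp (h p q hpq ⟨?_, fun p₁ p₂ h₁₂ ↦ ?_⟩)
  · by_contra hnt
    rw [not_nontrivial_iff_subsingleton] at hnt
    exact hp .of_subsingleton
  by_contra! hne
  have key : ∀ a b : Submodule R p, IsCompl a b → b ≠ ⊥ → InAdd R M a := by
    intro a b hab hb
    by_contra ha
    have hle : b.map p.subtype ≤ p := Submodule.map_subtype_le p b
    refine hmax (b.map p.subtype ⊔ q) ⟨a.map p.subtype, ?_, ?_⟩ ?_
    · have hd : Disjoint (a.map p.subtype) (b.map p.subtype) :=
        (Submodule.disjoint_map p.injective_subtype hab.disjoint)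
      have hs : a.map p.subtype ⊔ b.map p.subtype = p := by
        rw [← Submodule.map_sup, hab.sup_eq_top, Submodule.map_subtype_top]
      constructor
      · apply hd.disjoint_sup_right_of_disjoint_sup_left
        rw [hs]
        exact hpq.disjoint
      · rw [codisjoint_iff, ← sup_assoc, hs, hpq.sup_eq_top]
    · intro ha'
      exact ha (ha'.trans_retract
        (Submodule.equivMapOfInjective p.subtype p.injective_subtype a).toLinearMap
        (Submodule.equivMapOfInjective p.subtype p.injective_subtype a).symm.toLinearMap
        (by ext; simp))
    · refine lt_of_le_of_ne le_sup_right fun heq ↦ hb ?_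
      have : b.map p.subtype ≤ q := by rw [heq]; exact le_sup_left
      have h0 := hpq.disjoint hle this
      rw [le_bot_iff, ← Submodule.map_bot p.subtype] at h0
      exact Submodule.map_injective_of_injective p.injective_subtype h0
  exact hp (.of_isCompl h₁₂ (key _ _ h₁₂ hne.2) (key _ _ h₁₂.symm hne.1))

theorem IsRepresentationGenerator.inAdd [IsLocalRing R] [IsNoetherianRing R] {M Z : Type u}
    [AddCommGroup M] [Module R M] [AddCommGroup Z] [Module R Z] [Module.Finite R Z]
    (hM : IsRepresentationGenerator R M) {d : ℕ} (hd : ringKrullDim R = (d : WithBot ℕ∞))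
    (hZ : HasDepthGE R d Z) : InAdd R M Z := by
  refine inAdd_of_isIndecomposable_summands fun p q hpq hp ↦ ?_
  have := hp.nontrivial
  have hdp : HasDepthGE R d p := hZ.of_inAdd <| .of_retract p.subtype (p.projectionOnto q hpq)
    (Submodule.projectionOnto_comp_subtype hpq)
  obtain ⟨i, π, h⟩ := hM.isDirectSummand p (hdp.isMCM hd) hp
  exact .of_retract i π h

theorem isIndecomposableModule_self [IsLocalRing R] : IsIndecomposableModule R R where
  nontrivial := inferInstance
  eq_bot_or_eq_bot p q hpq := by
    obtain ⟨a, ha, b, hb, hab⟩ := Submodule.mem_sup.1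
      (hpq.sup_eq_top ▸ Submodule.mem_top : (1 : R) ∈ p ⊔ q)
    rcases IsLocalRing.isUnit_or_isUnit_of_add_one hab with h | h
    · right
      have : p = ⊤ := Ideal.eq_top_of_isUnit_mem p ha h
      simpa [this] using hpq.inf_eq_bot
    · left
      have : q = ⊤ := Ideal.eq_top_of_isUnit_mem q hb h
      simpa [this] using hpq.inf_eq_bot

end Decomposition


/-! ### The corner functor `X ↦ εX` and the comparison `X → Hom_R(εA, εX)`. -/

section Corner

variable {R : Type u} [CommRing R] {A : Type u} [Ring A] [Algebra R A]
  {X Y K : Type u} [AddCommGroup X] [Module R X] [Module A X] [IsScalarTower R A X]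
  [AddCommGroup Y] [Module R Y] [Module A Y] [IsScalarTower R A Y]
  [AddCommGroup K] [Module R K] [Module A K] [IsScalarTower R A K]

/-- The `R`-submodule of elements of `X` fixed by `ε`. -/
def corner (R : Type u) [CommRing R] {A : Type u} [Ring A] [Algebra R A] (ε : A) (X : Type u)
    [AddCommGroup X] [Module R X] [Module A X] [IsScalarTower R A X] : Submodule R X :=
  LinearMap.eqLocus (Algebra.lsmul R R X ε) LinearMap.id

variable {ε : A}

theorem mem_corner {x : X} : x ∈ corner R ε X ↔ ε • x = x := by
  simp [corner]

theorem smul_mem_corner {p : A} (hp : p ∈ corner R ε A) (x : X) : p • x ∈ corner R ε X := by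
  rw [mem_corner, smul_eq_mul] at hp
  rw [mem_corner, smul_smul, hp]

/-- The restriction of an `A`-linear map to corners. -/
def cornerMap (R : Type u) [CommRing R] {A : Type u} [Ring A] [Algebra R A] (ε : A)
    {X Y : Type u} [AddCommGroup X] [Module R X] [Module A X] [IsScalarTower R A X]
    [AddCommGroup Y] [Module R Y] [Module A Y] [IsScalarTower R A Y]
    (f : X →ₗ[A] Y) : corner R ε X →ₗ[R] corner R ε Y :=
  (f.restrictScalars R).restrict fun x hx ↦ by
    rw [mem_corner] at hx ⊢
    rw [LinearMap.restrictScalars_apply, ← map_smul, hx]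

@[simp]
theorem coe_cornerMap (f : X →ₗ[A] Y) (x : corner R ε X) : (cornerMap R ε f x : Y) = f x := rfl

theorem cornerMap_injective {f : X →ₗ[A] Y} (hf : Function.Injective f) :
    Function.Injective (cornerMap R ε f) :=
  fun _ _ h ↦ Subtype.ext (hf congr(($h : Y)))

theorem cornerMap_surjective (hε : ε * ε = ε) {f : X →ₗ[A] Y} (hf : Function.Surjective f) :
    Function.Surjective (cornerMap R ε f) := by
  rintro ⟨y, hy⟩
  obtain ⟨x, rfl⟩ := hf y
  refine ⟨⟨ε • x, ?_⟩, Subtype.ext ?_⟩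
  · rw [mem_corner, smul_smul, hε]
  · rw [mem_corner] at hy
    simpa using hy

theorem cornerMap_exact {f : K →ₗ[A] X} {g : X →ₗ[A] Y} (hf : Function.Injective f)
    (hfg : Function.Exact f g) : Function.Exact (cornerMap R ε f) (cornerMap R ε g) := by
  rintro ⟨x, hx⟩
  constructor
  · intro h
    obtain ⟨k, rfl⟩ := (hfg x).1 congr(($h : Y))
    refine ⟨⟨k, ?_⟩, rfl⟩
    rw [mem_corner] at hx ⊢
    exact hf (by rw [map_smul, hx])
  · rintro ⟨k, hk⟩
    rw [← hk]
    exact Subtype.ext (hfg.apply_apply_eq_zero _)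

theorem InAdd.corner (h : InAdd A X Y) : InAdd R (corner R ε X) (corner R ε Y) := by
  obtain ⟨ι, _, σ, τ, h⟩ := h
  refine ⟨ι, inferInstance, fun j ↦ cornerMap R ε (σ j), fun j ↦ cornerMap R ε (τ j), ?_⟩
  ext ⟨y, hy⟩
  simpa using congr($h y)

/-- The action map `X → Hom_R(εA, εX)`. -/
def toCornerHom (R : Type u) [CommRing R] {A : Type u} [Ring A] [Algebra R A] (ε : A)
    (X : Type u) [AddCommGroup X] [Module R X] [Module A X] [IsScalarTower R A X] (x : X) :
    corner R ε A →ₗ[R] corner R ε X where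
  toFun p := ⟨(p : A) • x, smul_mem_corner p.2 x⟩
  map_add' _ _ := Subtype.ext (add_smul _ _ _)
  map_smul' _ _ := Subtype.ext (smul_assoc _ _ _)

@[simp]
theorem coe_toCornerHom (x : X) (p : corner R ε A) : (toCornerHom R ε X x p : X) = (p : A) • x :=
  rfl

theorem toCornerHom_injective_iff : Function.Injective (toCornerHom R ε X) ↔
    ∀ x : X, (∀ p ∈ corner R ε A, p • x = 0) → x = 0 := by
  constructor
  · intro h x hx
    apply h
    ext p
    simpa using hx p p.2
  · intro h x y hxy
    rw [← sub_eq_zero]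
    refine h _ fun p hp ↦ ?_
    rw [smul_sub, sub_eq_zero]
    exact congr(($hxy ⟨p, hp⟩ : X))

theorem toCornerHom_injective_of_injective {f : X →ₗ[A] Y} (hf : Function.Injective f)
    (hY : Function.Injective (toCornerHom R ε Y)) : Function.Injective (toCornerHom R ε X) := by
  rw [toCornerHom_injective_iff] at hY ⊢
  intro x hx
  apply hf
  rw [map_zero]
  refine hY _ fun p hp ↦ ?_
  rw [← map_smul, hx p hp, map_zero]

/-- Left exactness of Hom and a diagram chase. With the preceding lemma: first syzygies have
injective comparison, second syzygies bijective. -/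
theorem toCornerHom_bijective_of_exact {f : K →ₗ[A] X} {g : X →ₗ[A] Y}
    (hf : Function.Injective f) (hfg : Function.Exact f g)
    (hX : Function.Bijective (toCornerHom R ε X)) (hY : Function.Injective (toCornerHom R ε Y)) :
    Function.Bijective (toCornerHom R ε K) := by
  refine ⟨toCornerHom_injective_of_injective hf hX.1, fun φ ↦ ?_⟩
  obtain ⟨x, hx⟩ := hX.2 (cornerMap R ε f ∘ₗ φ)
  have hx' : ∀ p : corner R ε A, (p : A) • x = f (φ p) := fun p ↦ congr(($hx p : X))
  have hgx : g x = 0 := by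
    refine toCornerHom_injective_iff.1 hY _ fun p hp ↦ ?_
    rw [← map_smul, hx' ⟨p, hp⟩, hfg.apply_apply_eq_zero]
  obtain ⟨k, rfl⟩ := (hfg x).1 hgx
  refine ⟨k, ?_⟩
  ext p
  apply hf
  rw [← hx', coe_toCornerHom, map_smul]

theorem toCornerHom_pi_bijective {ι : Type} (hX : Function.Bijective (toCornerHom R ε X)) :
    Function.Bijective (toCornerHom R ε (ι → X)) := by
  constructor
  · rw [toCornerHom_injective_iff]
    intro x hx
    ext j
    exact toCornerHom_injective_iff.1 hX.1 _ fun p hp ↦ congr($(hx p hp) j)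
  · intro φ
    choose x hx using fun j ↦ hX.2 (cornerMap R ε (LinearMap.proj j : (ι → X) →ₗ[A] X) ∘ₗ φ)
    refine ⟨x, ?_⟩
    ext p j
    exact congr(($(hx j) p : X))

/-- Bijectivity for `A` lifts `R`-maps `εX → εA` to `A`-maps `X → A`; bijectivity for `X` turns maps
`εA → εX` into elements of `X`, that is, `A`-maps `A → X`. So the retraction lifts. -/
theorem InAdd.of_corner (hA : Function.Bijective (toCornerHom R ε A))
    (hX : Function.Bijective (toCornerHom R ε X))
    (h : InAdd R (_root_.corner R ε A) (_root_.corner R ε X)) : InAdd A A X := by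
  obtain ⟨ι, _, σ, τ, h⟩ := h
  have hmul : ∀ (p : _root_.corner R ε A) (a : A), (p : A) * a ∈ _root_.corner R ε A :=
    fun p a ↦ smul_mem_corner p.2 a
  choose s hs using fun j x ↦ hA.2 (σ j ∘ₗ toCornerHom R ε X x)
  have hs' : ∀ j x (p : _root_.corner R ε A), (p : A) * s j x = σ j (toCornerHom R ε X x p) :=
    fun j x p ↦ congr(($(hs j x) p : A))
  choose y hy using fun j ↦ hX.2 (τ j)
  have hy' : ∀ j (p : _root_.corner R ε A), (p : A) • y j = τ j p :=
    fun j p ↦ congr(($(hy j) p : X))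
  refine ⟨ι, inferInstance, fun j ↦ ⟨⟨s j, fun x x' ↦ ?_⟩, fun a x ↦ ?_⟩,
    fun j ↦ LinearMap.toSpanSingleton A X (y j), ?_⟩
  · apply hA.1
    ext p
    simp only [coe_toCornerHom, smul_eq_mul, mul_add, hs']
    rw [← Submodule.coe_add, ← map_add]
    congr 2
    ext
    simp
  · apply hA.1
    ext p
    simp only [coe_toCornerHom, smul_eq_mul, hs', RingHom.id_apply]
    -- `σ j` is only `R`-linear; `A`-linearity of the lift comes from `p(ax) = (pa)x` with `pa`
    -- again in `εA`.
    rw [← mul_assoc, hs' j x ⟨p * a, hmul p a⟩]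
    congr 2
    ext
    simp [mul_smul]
  · ext x
    apply hX.1
    ext p
    have h1 := congr(($h (toCornerHom R ε X x p) : X))
    simp only [LinearMap.sum_apply, LinearMap.comp_apply, LinearMap.id_apply,
      AddSubmonoidClass.coe_finsetSum] at h1
    simp only [LinearMap.sum_apply, LinearMap.comp_apply, LinearMap.id_apply,
      LinearMap.coe_mk, AddHom.coe_mk, LinearMap.toSpanSingleton_apply, coe_toCornerHom,
      Finset.smul_sum]
    rw [coe_toCornerHom] at h1
    rw [← h1]
    refine Finset.sum_congr rfl fun j _ ↦ ?_
    rw [smul_smul, ← hy' j, hs']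

end Corner

/-! ### Projective dimension over `A` against depth of corners. -/

section ProjectiveDimension

variable {R : Type u} [CommRing R] [IsLocalRing R] [IsNoetherianRing R]
  {A : Type u} [Ring A] [Algebra R A] [Module.Finite R A] {ε : A}

/-- Here `c` bounds the depth still missing: each syzygy keeps the comparison bijective and lowers
`c` by one. -/
theorem hasProjectiveDimensionLT_of_toCornerHom_bijective (hε : ε * ε = ε)
    (hA : Function.Bijective (toCornerHom R ε A)) {d : ℕ}
    (hdA : HasDepthGE R d (corner R ε A))
    (hadd : ∀ (Z : Type u) [AddCommGroup Z] [Module R Z] [Module.Finite R Z], HasDepthGE R d Z →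
      InAdd R (corner R ε A) Z)
    (c : ℕ) (X : Type u) [AddCommGroup X] [Module R X] [Module A X] [IsScalarTower R A X]
    [Module.Finite A X] (hX : Function.Bijective (toCornerHom R ε X))
    (hdX : HasDepthGE R (d - c) (corner R ε X)) :
    HasProjectiveDimensionLT (ModuleCat.of A X) (c + 1) := by
  have : IsNoetherianRing A := isNoetherian_of_tower R inferInstance
  induction c generalizing X with
  | zero =>
    have : Module.Finite R X := Module.Finite.trans A X
    have : Module.Projective A X := (InAdd.of_corner hA hX (hadd _ hdX)).projective
    have : Projective (ModuleCat.of A X) := (IsProjective.iff_projective _).1 this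
    infer_instance
  | succ c ih =>
    obtain ⟨n, f, hf⟩ := Module.Finite.exists_fin' A X
    have hF := toCornerHom_pi_bijective (ι := Fin n) hA
    have hdF : HasDepthGE R d (corner R ε (Fin n → A)) := hdA.of_inAdd (InAdd.pi (Fin n)).corner
    have hex := LinearMap.exact_subtype_ker_map f
    have hK := toCornerHom_bijective_of_exact f.ker.injective_subtype hex hF hX.1
    refine ((LinearMap.shortExact_shortComplexKer hf).hasProjectiveDimensionLT_X₃ (c + 1)
      (ih f.ker hK ?_) ?_)
    · rcases Nat.eq_zero_or_pos (d - c) with h0 | h0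
      · rw [h0]; exact .zero
      obtain ⟨e, he⟩ : ∃ e, d - c = e + 1 := ⟨d - c - 1, by omega⟩
      rw [he]
      exact HasDepthGE.kernel (cornerMap_injective f.ker.injective_subtype)
        (cornerMap_exact f.ker.injective_subtype hex) (cornerMap_surjective hε hf)
        (hdF.mono (by omega)) (hdX.mono (by omega))
    · have : Projective (ModuleCat.of A (Fin n → A)) :=
        (IsProjective.iff_projective _).1 inferInstance
      exact hasProjectiveDimensionLT_of_ge _ 1 _ (by omega)

theorem hasProjectiveDimensionLT_of_finite (hε : ε * ε = ε)
    (hA : Function.Bijective (toCornerHom R ε A)) {d : ℕ}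
    (hdA : HasDepthGE R d (corner R ε A))
    (hadd : ∀ (Z : Type u) [AddCommGroup Z] [Module R Z] [Module.Finite R Z], HasDepthGE R d Z →
      InAdd R (corner R ε A) Z)
    (X : Type u) [AddCommGroup X] [Module R X] [Module A X] [IsScalarTower R A X]
    [Module.Finite A X] : HasProjectiveDimensionLT (ModuleCat.of A X) (max 2 d + 1) := by
  have : IsNoetherianRing A := isNoetherian_of_tower R inferInstance
  have hproj (n : ℕ) : Projective (ModuleCat.of A (Fin n → A)) :=
    (IsProjective.iff_projective _).1 inferInstance
  have hF (n : ℕ) := toCornerHom_pi_bijective (ι := Fin n) hA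
  have hdF (n : ℕ) : HasDepthGE R d (corner R ε (Fin n → A)) :=
    hdA.of_inAdd (InAdd.pi (Fin n)).corner
  have hdK {n c : ℕ} {Y : Type u} [AddCommGroup Y] [Module R Y] [Module A Y]
      [IsScalarTower R A Y] {f : (Fin n → A) →ₗ[A] Y} (hf : Function.Surjective f)
      (hY : HasDepthGE R c (corner R ε Y)) (hc : c + 1 ≤ d) :
      HasDepthGE R (c + 1) (corner R ε f.ker) :=
    HasDepthGE.kernel (cornerMap_injective f.ker.injective_subtype)
      (cornerMap_exact f.ker.injective_subtype (LinearMap.exact_subtype_ker_map f))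
      (cornerMap_surjective hε hf) ((hdF n).mono hc) hY
  obtain ⟨n, f, hf⟩ := Module.Finite.exists_fin' A X
  obtain ⟨m, g, hg⟩ := Module.Finite.exists_fin' A f.ker
  have hK := toCornerHom_injective_of_injective f.ker.injective_subtype (hF n).1
  have hL := toCornerHom_bijective_of_exact g.ker.injective_subtype
    (LinearMap.exact_subtype_ker_map g) (hF m) hK
  -- With truncated subtraction this is `min 2 d`, the depth gained by two syzygies.
  have hdL : HasDepthGE R (d - (d - 2)) (corner R ε g.ker) := by
    rcases d with _ | _ | d
    · exact .zero
    · exact hdK hg .zero le_rfl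
    · exact (hdK hg (hdK hf .zero (by omega)) (by omega)).mono (by omega)
  have h1 := hasProjectiveDimensionLT_of_toCornerHom_bijective hε hA hdA hadd (d - 2) g.ker hL hdL
  have h2 := (LinearMap.shortExact_shortComplexKer hg).hasProjectiveDimensionLT_X₃ (d - 2 + 1) h1
    (hasProjectiveDimensionLT_of_ge _ 1 _ (by omega))
  have h3 := (LinearMap.shortExact_shortComplexKer hf).hasProjectiveDimensionLT_X₃ (d - 2 + 1 + 1) h2
    (hasProjectiveDimensionLT_of_ge _ 1 _ (by omega))
  rwa [show d - 2 + 1 + 1 + 1 = max 2 d + 1 by omega] at h3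

/-- Each step of a projective resolution costs at most one unit of depth, starting from `d` for
projectives. -/
theorem hasDepthGE_corner_of_hasProjectiveDimensionLT (hε : ε * ε = ε) {d : ℕ}
    (hdA : HasDepthGE R d (corner R ε A)) (n : ℕ) (hn : n ≤ d)
    (X : Type u) [AddCommGroup X] [Module R X] [Module A X] [IsScalarTower R A X]
    [Module.Finite A X] (hX : HasProjectiveDimensionLT (ModuleCat.of A X) (n + 1)) :
    HasDepthGE R (d - n) (corner R ε X) := by
  have : IsNoetherianRing A := isNoetherian_of_tower R inferInstance
  induction n generalizing X with
  | zero =>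
    have : Projective (ModuleCat.of A X) := projective_iff_hasProjectiveDimensionLT_one.2 hX
    have : Module.Projective A X := (IsProjective.iff_projective _).2 this
    exact hdA.of_inAdd InAdd.of_projective.corner
  | succ n ih =>
    obtain ⟨m, f, hf⟩ := Module.Finite.exists_fin' A X
    have : Projective (ModuleCat.of A (Fin m → A)) := (IsProjective.iff_projective _).1 inferInstance
    have hdF : HasDepthGE R d (corner R ε (Fin m → A)) := hdA.of_inAdd (InAdd.pi (Fin m)).corner
    have hK := ih (by omega) f.ker <|
      ((LinearMap.shortExact_shortComplexKer hf).hasProjectiveDimensionLT_X₃_iff n this).1 hX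
    exact HasDepthGE.cokernel (cornerMap_injective f.ker.injective_subtype)
      (cornerMap_exact f.ker.injective_subtype (LinearMap.exact_subtype_ker_map f))
      (cornerMap_surjective hε hf) (hdF.mono (by omega)) (hK.mono (by omega))

/-- The left ideal `𝔪A`. -/
def maximalIdealSMulTop (R : Type u) [CommRing R] [IsLocalRing R] (A : Type u) [Ring A]
    [Algebra R A] : Ideal A where
  __ := IsLocalRing.maximalIdeal R • (⊤ : Submodule R A)
  smul_mem' a x hx := by
    have h : (IsLocalRing.maximalIdeal R • (⊤ : Submodule R A)).map (LinearMap.mulLeft R a) ≤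
        IsLocalRing.maximalIdeal R • (⊤ : Submodule R A) := by
      rw [Submodule.map_smul'']
      exact Submodule.smul_mono le_rfl le_top
    exact h ⟨x, hx, rfl⟩

omit [IsNoetherianRing R] [Module.Finite R A] in
theorem mem_maximalIdealSMulTop {a : A} : a ∈ maximalIdealSMulTop R A ↔
    a ∈ IsLocalRing.maximalIdeal R • (⊤ : Submodule R A) := Iff.rfl

omit [IsNoetherianRing R] in
theorem not_hasDepthGE_one_of_smul_eq_zero {N : Type u} [AddCommGroup N] [Module R N] {x : N}
    (hx : x ≠ 0) (h : ∀ r ∈ IsLocalRing.maximalIdeal R, r • x = 0) : ¬ HasDepthGE R 1 N := by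
  intro hN
  let f : (R ⧸ IsLocalRing.maximalIdeal R) →ₗ[R] N :=
    Submodule.liftQ _ (LinearMap.toSpanSingleton R N x) fun r hr ↦ by simpa using h r hr
  have hf : ModuleCat.ofHom f = 0 :=
    Ext.addEquiv₀.symm.injective ((hN 0 one_pos).elim _ _)
  apply hx
  have h1 : f (Submodule.Quotient.mk 1) = 0 := congr($(hf).hom (Submodule.Quotient.mk 1))
  rwa [Submodule.liftQ_apply, LinearMap.toSpanSingleton_apply, one_smul] at h1

theorem not_hasDepthGE_one_corner_quotient (hε : ε * ε = ε) [Nontrivial (corner R ε A)] :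
    ¬ HasDepthGE R 1 (corner R ε (A ⧸ maximalIdealSMulTop R A)) := by
  -- Nakayama gives `q` in `εA` outside `𝔪εA`; its class in `A/𝔪A` is the required nonzero element
  -- killed by `𝔪`.
  obtain ⟨q, -, hq⟩ := SetLike.exists_of_lt (smul_maximalIdeal_lt_top (R := R)
    (L := corner R ε A))
  have hmem : (maximalIdealSMulTop R A).mkQ q ∈ corner R ε (A ⧸ maximalIdealSMulTop R A) := by
    rw [mem_corner, ← map_smul, mem_corner.1 q.2]
  refine not_hasDepthGE_one_of_smul_eq_zero (x := ⟨_, hmem⟩) (fun h0 ↦ hq ?_) fun r hr ↦ ?_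
  · have h1 : (q : A) ∈ maximalIdealSMulTop R A := by
      have := congr(($h0 : A ⧸ maximalIdealSMulTop R A))
      simpa using this
    -- Left multiplication by `ε` retracts `A` onto `εA` and sends `𝔪A` into `𝔪εA`.
    let π : A →ₗ[R] corner R ε A := (Algebra.lsmul R R A ε).codRestrict _ fun a ↦ by
      rw [mem_corner]; simp [← mul_assoc, hε]
    have h2 : π q = q := Subtype.ext (mem_corner.1 q.2)
    rw [← h2]
    have h3 : (IsLocalRing.maximalIdeal R • (⊤ : Submodule R A)).map π ≤
        IsLocalRing.maximalIdeal R • ⊤ := by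
      rw [Submodule.map_smul'']
      exact Submodule.smul_mono le_rfl le_top
    exact h3 ⟨q, mem_maximalIdealSMulTop.1 h1, rfl⟩
  · have h1 : r • (q : A) ∈ maximalIdealSMulTop R A :=
      mem_maximalIdealSMulTop.2 (Submodule.smul_mem_smul hr Submodule.mem_top)
    have h2 : r • (maximalIdealSMulTop R A).mkQ (q : A) = 0 := by
      rw [← LinearMap.map_smul_of_tower, Submodule.mkQ_apply, Submodule.Quotient.mk_eq_zero]
      exact h1
    exact Subtype.ext h2

theorem leftGlobalDimension_le (hε : ε * ε = ε)
    (hA : Function.Bijective (toCornerHom R ε A)) {d : ℕ}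
    (hdA : HasDepthGE R d (corner R ε A))
    (hadd : ∀ (Z : Type u) [AddCommGroup Z] [Module R Z] [Module.Finite R Z], HasDepthGE R d Z →
      InAdd R (corner R ε A) Z) :
    leftGlobalDimension A ≤ ((max 2 d : ℕ) : WithBot ℕ∞) := by
  refine iSup_le fun X ↦ ?_
  rw [projectiveDimension_le_iff]
  exact ModuleCat.hasProjectiveDimensionLT_of_cyclic _
    (fun I ↦ hasProjectiveDimensionLT_of_finite hε hA hdA hadd (A ⧸ I)) X

theorem le_leftGlobalDimension (hε : ε * ε = ε) [Nontrivial (corner R ε A)] {d : ℕ}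
    (hd : 1 ≤ d) (hdA : HasDepthGE R d (corner R ε A)) :
    (d : WithBot ℕ∞) ≤ leftGlobalDimension A := by
  refine le_iSup_of_le (ModuleCat.of A (A ⧸ maximalIdealSMulTop R A)) ?_
  rw [projectiveDimension_ge_iff]
  intro h
  obtain ⟨d, rfl⟩ := Nat.exists_eq_add_of_le' hd
  refine not_hasDepthGE_one_corner_quotient (R := R) hε ?_
  exact (hasDepthGE_corner_of_hasProjectiveDimensionLT hε hdA d (Nat.le_succ d) _ h).mono
    (by omega)

end ProjectiveDimension


/-! ### The corner of the opposite endomorphism ring. -/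

section Endomorphisms

variable {R : Type u} [CommRing R] {M : Type u} [AddCommGroup M] [Module R M]
  (i : R →ₗ[R] M) (π : M →ₗ[R] R)

/-- The idempotent of `End_R(M)ᵐᵒᵖ` attached to a splitting `R → M → R`. -/
def splitIdempotent : (Module.End R M)ᵐᵒᵖ := MulOpposite.op (i ∘ₗ π)

variable {i π}

theorem splitIdempotent_mul_self (h : π ∘ₗ i = LinearMap.id) :
    splitIdempotent i π * splitIdempotent i π = splitIdempotent i π := by
  apply MulOpposite.unop_injective
  ext x
  have h1 := congr($h (π x))
  simp only [LinearMap.comp_apply, LinearMap.id_apply] at h1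
  simp [splitIdempotent, h1]

/-- The corner of `End_R(M)ᵐᵒᵖ` at the idempotent of a splitting `R → M → R` is `M`. -/
def cornerEquiv (h : π ∘ₗ i = LinearMap.id) :
    corner R (splitIdempotent i π) (Module.End R M)ᵐᵒᵖ ≃ₗ[R] M where
  toFun q := (q : (Module.End R M)ᵐᵒᵖ).unop (i 1)
  map_add' _ _ := rfl
  map_smul' _ _ := rfl
  invFun m := ⟨MulOpposite.op (LinearMap.toSpanSingleton R M m ∘ₗ π), by
    rw [mem_corner]
    apply MulOpposite.unop_injective
    ext x
    have h1 := congr($h (π x))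
    simp only [LinearMap.comp_apply, LinearMap.id_apply] at h1
    simp [splitIdempotent, h1]⟩
  left_inv q := by
    -- In the opposite ring, `εq = q` says that the endomorphism satisfies `q ∘ i ∘ π = q`, so `q`
    -- is determined by `q (i 1)`.
    have hq := mem_corner.1 q.2
    apply Subtype.ext
    apply MulOpposite.unop_injective
    ext x
    have h1 : (q : (Module.End R M)ᵐᵒᵖ).unop (i (π x)) = (q : (Module.End R M)ᵐᵒᵖ).unop x :=
      congr(($hq).unop x)
    simp only [MulOpposite.unop_op, LinearMap.comp_apply, LinearMap.toSpanSingleton_apply]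
    rw [← h1, ← map_smul, ← map_smul, smul_eq_mul, mul_one]
  right_inv m := by
    have h1 := congr($h 1)
    simp only [LinearMap.comp_apply, LinearMap.id_apply] at h1
    simp [h1]

/-- Under `cornerEquiv`, the action of `g` on the corner is evaluation of `g` on `M`. -/
theorem toCornerHom_bijective_of_split (h : π ∘ₗ i = LinearMap.id) :
    Function.Bijective (toCornerHom R (splitIdempotent i π) (Module.End R M)ᵐᵒᵖ) := by
  have key (g : (Module.End R M)ᵐᵒᵖ) (q) :
      cornerEquiv h (toCornerHom R _ _ g q) = g.unop (cornerEquiv h q) := rfl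
  constructor
  · intro g g' hg
    apply MulOpposite.unop_injective
    ext m
    obtain ⟨q, rfl⟩ := (cornerEquiv h).surjective m
    rw [← key, ← key, hg]
  · intro φ
    refine ⟨MulOpposite.op ((cornerEquiv h).toLinearMap ∘ₗ φ ∘ₗ (cornerEquiv h).symm.toLinearMap),
      LinearMap.ext fun q ↦ (cornerEquiv h).injective ?_⟩
    rw [key]
    simp

end Endomorphisms

end

/-! ### Assembly of the two bounds. -/

theorem theorem2p1 (R : Type u) [CommRing R] (hR : IsCMLocalRing R)
    (d : ℕ) (hd : ringKrullDim R = (d : WithBot ℕ∞)) (hfin : HasFiniteCMType R)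
    (M : Type u) [AddCommGroup M] [Module R M] (hM : IsRepresentationGenerator R M) :
    IsDirectSummand R R M ∧
    leftGlobalDimension (Module.End R M)ᵐᵒᵖ ≤ ((max 2 d : ℕ) : WithBot ℕ∞) ∧
    (2 ≤ d → leftGlobalDimension (Module.End R M)ᵐᵒᵖ = ((max 2 d : ℕ) : WithBot ℕ∞)) := by
  have := hR.isLocalRing
  have := hR.isNoetherianRing
  have := hM.isMCM.finite
  have := hM.isMCM.nontrivial
  have hRM : IsDirectSummand R R M :=
    hM.isDirectSummand R hR.isMCM_self isIndecomposableModule_self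
  obtain ⟨i, π, h⟩ := id hRM
  have : Module.Finite R (Module.End R M) :=
    Module.IsNoetherian.finite R (M →ₗ[R] M)
  have : Module.Finite R (Module.End R M)ᵐᵒᵖ :=
    Module.Finite.equiv (MulOpposite.opLinearEquiv R)
  let e := cornerEquiv h
  have hε := splitIdempotent_mul_self h
  have hdA : HasDepthGE R d (corner R (splitIdempotent i π) (Module.End R M)ᵐᵒᵖ) :=
    (hM.isMCM.hasDepthGE hd).of_inAdd (.of_linearEquiv e)
  have hle : leftGlobalDimension (Module.End R M)ᵐᵒᵖ ≤ ((max 2 d : ℕ) : WithBot ℕ∞) :=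
    leftGlobalDimension_le hε (toCornerHom_bijective_of_split h) hdA
      fun Z _ _ _ hZ ↦ (hM.inAdd hd hZ).congr_left e.symm
  refine ⟨hRM, hle, fun h2 ↦ le_antisymm hle ?_⟩
  have : Nontrivial (corner R (splitIdempotent i π) (Module.End R M)ᵐᵒᵖ) := e.nontrivial
  rw [max_eq_right h2]
  exact le_leftGlobalDimension hε (by omega) hdA
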